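/- An arborescence is a finite directed tree with a root such that all edges are directed away from the root, i.e. there is a unique directed path from the root to every vertex; if $u\to v$ is an edge, $v$ is called a parent of $u$. An ordering of the vertices is leaf-to-root if every vertex is presented after all of its parents (its out-neighbours). It is geometric if, moreover, for every vertex $u$ the following holds: list in the order of their presentation the vertices $v_1,v_2,\dots$ that are roots (have no in-neighbour) in the digraph induced by the vertices presented before $u$; then the parents of $u$ form an interval of this list, i.e. $\{v_i : u\to v_i\}=\{v_i : l<i<r\}$ for some $l$ and $r$. A semi-online $k$-colouring algorithm receives the vertices of an unknown arborescence one by one in a geometric leaf-to-root order, each together with its edges to the vertices presented before. After each step it has a partial colouring, with $k$ colours, of the vertices presented so far, which is determined by the digraph and the order presented so far; at each step it may colour any of the uncoloured vertices, but it can never change or remove a colour. The length of a directed path is its number of edges. **Theorem.** Let $k,m\ge 0$ be integers. There is no semi-online $k$-colouring algorithm for arborescences presented in geometric leaf-to-root order which maintains that, at every stage, every directed path of length $m$ among the vertices presented so far contains at least two colours. That is, for every semi-online $k$-colouring algorithm there are an arborescence with a geometric leaf-to-root order and a stage at which some directed path of length $m$ contains at most one colour (uncoloured vertices being allowed). Thus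 every such algorithm can be forced to produce arbitrarily long paths that carry at most one colour. -/

import Mathlib

namespace SemiOnline

/-- A digraph is an arborescence if it has a root `r` such that there is a unique
directed path from `r` to every vertex (Mathlib's notion for quivers). Edges point away from the
root. -/
def IsArborescence {V : Type*} (G : Digraph V) : Prop :=
  Nonempty (@Quiver.Arborescence V ⟨fun u v => PLift (G.Adj u v)⟩)

/-!
A digraph whose vertices are presented one by one is a digraph on `Fin n`, where vertex `i` is the
`i`-th one (counted from `0`) to be presented. If `u → v` is an edge, `v` is called a parent of `u`.
-/

/-- The natural order of `Fin n` is a leaf-to-root order: every vertex is preceded by all of its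
out-neighbours (its parents), hence succeeded by all of its in-neighbours. -/
def IsLeafToRoot {n : ℕ} (G : Digraph (Fin n)) : Prop :=
  ∀ u v, G.Adj u v → v < u

/-- Just before `u` is presented, `v` has been presented and is a root, i.e. none of the vertices
presented so far has an edge to `v`. -/
def IsRootBefore {n : ℕ} (G : Digraph (Fin n)) (u v : Fin n) : Prop :=
  v < u ∧ ∀ w, w < u → ¬ G.Adj w v

/-- The natural order of `Fin n` is a geometric leaf-to-root order: moreover, the parents of every
vertex `u` form an interval among the roots that are there just before `u` is presented, where the
roots are listed in the order of their presentation. -/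
def IsGeometricLeafToRoot {n : ℕ} (G : Digraph (Fin n)) : Prop :=
  IsLeafToRoot G ∧
    ∀ u a b c, IsRootBefore G u a → IsRootBefore G u b → IsRootBefore G u c →
      a < b → b < c → G.Adj u a → G.Adj u c → G.Adj u b

/-- The part of the digraph that is known after `i` vertices have been presented: the subgraph
induced by the first `i` vertices. -/
def stage {n : ℕ} (G : Digraph (Fin n)) (i : ℕ) (hi : i ≤ n) : Digraph (Fin i) :=
  ⟨fun u v => G.Adj (Fin.castLE hi u) (Fin.castLE hi v)⟩

/-- A (deterministic) semi-online `k`-colouring algorithm for arborescences that are presented in a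
geometric leaf-to-root order. After each step it has a partial colouring of the vertices presented
so far (`none` means uncoloured), which depends only on what has been presented so far. At each
step any set of uncoloured vertices may be coloured, but no colour is ever changed or removed.

Nothing is required on inputs that do not come from a geometric leaf-to-root order, so that
an algorithm for arbitrary leaf-to-root orders is in particular such an algorithm. -/
structure Algorithm (k : ℕ) where
  /-- The partial colouring after the digraph on the first `i` vertices has been presented. -/
  colour : (i : ℕ) → Digraph (Fin i) → Fin i → Option (Fin k)
  irrevocable : ∀ (n : ℕ) (G : Digraph (Fin n)), IsArborescence G → IsGeometricLeafToRoot G →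
    ∀ (i j : ℕ) (hij : i ≤ j) (hj : j ≤ n) (v : Fin i) (c : Fin k),
      colour i (stage G i (hij.trans hj)) v = some c →
        colour j (stage G j hj) (Fin.castLE hij v) = some c

/-- `p` is a directed path of length `m` (with `m` edges, hence `m + 1` vertices) in `G`. -/
def IsDirectedPath {V : Type*} (G : Digraph V) (m : ℕ) (p : Fin (m + 1) → V) : Prop :=
  Function.Injective p ∧ ∀ j : Fin m, G.Adj (p j.castSucc) (p j.succ)

/-- The set of colours that occur on `p` in a partial colouring. -/
def pathColours {V : Type*} {k m : ℕ} (f : V → Option (Fin k)) (p : Fin (m + 1) → V) :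
    Set (Fin k) :=
  {c | ∃ j, f (p j) = some c}

/-- On every arborescence in a geometric leaf-to-root order, at every stage, every directed path of
length `m` contains at least two colours. -/
def Algorithm.IsProper {k : ℕ} (A : Algorithm k) (m : ℕ) : Prop :=
  ∀ (n : ℕ) (G : Digraph (Fin n)), IsArborescence G → IsGeometricLeafToRoot G →
    ∀ (i : ℕ) (hi : i ≤ n) (p : Fin (m + 1) → Fin i), IsDirectedPath (stage G i hi) m p →
      (pathColours (A.colour i (stage G i hi)) p).Nontrivial

end SemiOnline

/-!
Suppose that an algorithm `A` keeps two colours on every directed path of length `m`.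

The adversary only uses moves that join a final segment of the list of current roots under a new
vertex. Such a play is encoded by a sequence `s : ℕ → ℕ`: vertex `u` is joined to all current roots
`v ≥ s u`. Every such play is geometric, and one more vertex joined to all roots turns it into an
arborescence, so the algorithm has to cope with it.

The *type* of depth `d` of a vertex records its colour and the set of types of depth `d - 1` of its
out-neighbours; there are only finitely many types of depth `m`. The key point
(`exists_path_of_vertexType_eq`) is the following. Let a new vertex `z` be joined to `y`, and suppose
that the type of `z` at some later time equals the type that `y` had before. Then `y` had an
out-neighbour `y₁` whose earlier type was the later type of `y`, hence an out-neighbour `y₂` of `y₁`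
whose earlier type was the later type of `y₁`, and so on. As colours are never changed, the earlier
colours along `y, y₁, y₂, …` are first none and then constant: a path with at most one colour. Thus a
vertex joined to a set of roots always gets a type that none of those roots had.

Since a vertex is coloured at most once, the adversary can play on until the colours of any given
finite part are frozen as long as its roots are left alone (`exists_frozen`). Hence the number of
distinct frozen types of roots can be increased indefinitely (`exists_many_types`): having produced
a set of frozen roots with `t` types, produce a second such set; either one of the types of the first
does not occur in the second, or joining the second set yields a type that does not occur in the
first. This contradicts the finiteness of the set of types.
-/

namespace SemiOnline

/-! ### Plays that join final segments of the list of roots -/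

/-- The edges of the play encoded by `s`: vertex `u` is joined to all vertices `v` with
`s u ≤ v < u` that are still roots, i.e. that no vertex `w` strictly between them has been
joined to. -/
def PlayAdj (s : ℕ → ℕ) (u v : ℕ) : Prop :=
  s u ≤ v ∧ v < u ∧ ∀ w, v < w → w < u → v < s w

/-- The digraph presented in the first `n` steps of the play `s`. -/
def playGraph (s : ℕ → ℕ) (n : ℕ) : Digraph (Fin n) :=
  ⟨fun u v => PlayAdj s u v⟩

theorem playAdj_congr {s s' : ℕ → ℕ} {n u : ℕ} (h : ∀ w < n, s' w = s w) (hu : u < n) (v : ℕ) :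
    PlayAdj s' u v ↔ PlayAdj s u v := by
  unfold PlayAdj
  rw [h u hu]
  refine and_congr_right fun _ => and_congr_right fun _ => ?_
  refine forall_congr' fun w => imp_congr_right fun _ => ⟨fun H hw => ?_, fun H hw => ?_⟩
  · rw [← h w (hw.trans hu)]; exact H hw
  · rw [h w (hw.trans hu)]; exact H hw

theorem playGraph_congr {s s' : ℕ → ℕ} {n : ℕ} (h : ∀ w < n, s' w = s w) :
    playGraph s' n = playGraph s n := by
  unfold playGraph
  congr 1
  funext u v
  exact propext (playAdj_congr h u.2 v)

theorem isGeometricLeafToRoot_playGraph (s : ℕ → ℕ) (n : ℕ) :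
    IsGeometricLeafToRoot (playGraph s n) := by
  refine ⟨fun u v h => h.2.1, fun u a b c _ hb _ hab _ hua _ => ?_⟩
  refine ⟨hua.1.trans hab.le, hb.1, fun w hbw hwu => ?_⟩
  -- Otherwise the first vertex after `b` whose segment contains `b` would be joined to `b`.
  by_contra hw
  classical
  have hex : ∃ w, (b : ℕ) < w ∧ s w ≤ b := ⟨w, hbw, not_lt.1 hw⟩
  have hle : Nat.find hex ≤ w := Nat.find_min' hex ⟨hbw, not_lt.1 hw⟩
  have hlt : Nat.find hex < u := hle.trans_lt hwu
  refine hb.2 ⟨Nat.find hex, hlt.trans u.2⟩ hlt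
    ⟨(Nat.find_spec hex).2, (Nat.find_spec hex).1, fun x hx hx' => ?_⟩
  by_contra hxs
  exact Nat.find_min hex hx' ⟨hx, not_lt.1 hxs⟩

/-- If the last vertex is joined to all roots, then the play is an arborescence. -/
theorem isArborescence_playGraph {s : ℕ → ℕ} {n : ℕ} (h : s n = 0) :
    IsArborescence (playGraph s (n + 1)) := by
  let _ : Quiver (Fin (n + 1)) := ⟨fun u v => PLift ((playGraph s (n + 1)).Adj u v)⟩
  refine ⟨Quiver.arborescenceMk (Fin.last n) (fun v => n - v) ?_ ?_ ?_⟩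
  · rintro a b ⟨e⟩
    have h1 : (b : ℕ) < a := e.2.1
    have h2 := a.2
    change n - (a : ℕ) < n - (b : ℕ)
    omega
  · rintro a b c ⟨e⟩ ⟨f⟩
    have hab : a = b := by
      apply Fin.ext
      rcases lt_trichotomy (a : ℕ) b with hlt | heq | hlt
      · exact absurd e.1 (not_le.2 (f.2.2 a e.2.1 hlt))
      · exact heq
      · exact absurd f.1 (not_le.2 (e.2.2 b f.2.1 hlt))
    subst hab
    exact ⟨rfl, HEq.rfl⟩
  · intro b
    rcases eq_or_ne b (Fin.last n) with hb | hb
    · exact Or.inl hb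
    · right
      have hbn : (b : ℕ) < n := Fin.val_lt_last hb
      classical
      have hex : ∃ w, (b : ℕ) < w ∧ s w ≤ b := ⟨n, hbn, by omega⟩
      have hle : Nat.find hex ≤ n := Nat.find_min' hex ⟨hbn, by omega⟩
      refine ⟨⟨Nat.find hex, by omega⟩, ⟨⟨(Nat.find_spec hex).2, (Nat.find_spec hex).1,
        fun x hx hx' => ?_⟩⟩⟩
      by_contra hxs
      exact Nat.find_min hex hx' ⟨hx, not_lt.1 hxs⟩

/-! ### Continuing a play without touching the current roots -/

/-- The first `n'` steps of `s'` continue the first `n` steps of `s`, and none of the further steps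
joins a new vertex to one of the first `n` vertices. -/
def Extends (s : ℕ → ℕ) (n : ℕ) (s' : ℕ → ℕ) (n' : ℕ) : Prop :=
  n ≤ n' ∧ (∀ u < n, s' u = s u) ∧ ∀ u, n ≤ u → u < n' → n ≤ s' u

theorem Extends.refl (s : ℕ → ℕ) (n : ℕ) : Extends s n s n :=
  ⟨le_rfl, fun _ _ => rfl, fun _ h h' => absurd h (not_le.2 h')⟩

theorem Extends.trans {s s' s'' : ℕ → ℕ} {n n' n'' : ℕ} (h : Extends s n s' n')
    (h' : Extends s' n' s'' n'') : Extends s n s'' n'' := by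
  refine ⟨h.1.trans h'.1, fun u hu => (h'.2.1 u (hu.trans_le h.1)).trans (h.2.1 u hu),
    fun u hu hu' => ?_⟩
  rcases lt_or_ge u n' with hlt | hge
  · rw [h'.2.1 u hlt]
    exact h.2.2 u hu hlt
  · exact h.1.trans (h'.2.2 u hge hu')

/-- Vertex `v` has no in-neighbour among the first `n` vertices of the play `s`. -/
def IsPlayRoot (s : ℕ → ℕ) (n v : ℕ) : Prop :=
  ∀ w, v < w → w < n → v < s w

theorem Extends.isPlayRoot {s s' : ℕ → ℕ} {n n' v : ℕ} (h : Extends s n s' n') (hv : v < n)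
    (hr : IsPlayRoot s n v) : IsPlayRoot s' n' v := by
  intro w hvw hw
  rcases lt_or_ge w n with hlt | hge
  · rw [h.2.1 w hlt]
    exact hr w hvw hlt
  · exact hv.trans_le (h.2.2 w hge hw)

/-! ### The colours that the algorithm uses on a play -/

variable {k : ℕ}

/-- The colour of vertex `v` after `n` steps of the play `s`; vertices that have not been presented
yet are uncoloured. -/
def Algorithm.playColour (A : Algorithm k) (s : ℕ → ℕ) (n v : ℕ) : Option (Fin k) :=
  if h : v < n then A.colour n (playGraph s n) ⟨v, h⟩ else none

theorem Algorithm.playColour_congr (A : Algorithm k) {s s' : ℕ → ℕ} {n : ℕ}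
    (h : ∀ w < n, s' w = s w) : A.playColour s' n = A.playColour s n := by
  funext v
  unfold Algorithm.playColour
  rw [playGraph_congr h]

theorem update_eq_of_lt (s : ℕ → ℕ) (n a : ℕ) : ∀ w < n, Function.update s n a w = s w :=
  fun _ hw => Function.update_of_ne hw.ne _ _

theorem Algorithm.playColour_mono (A : Algorithm k) {s : ℕ → ℕ} {i j v : ℕ} (hij : i ≤ j)
    {c : Fin k} (h : A.playColour s i v = some c) : A.playColour s j v = some c := by
  -- Irrevocability only speaks of arborescences, so the play is completed after step `j`.
  have hj := update_eq_of_lt s j 0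
  rw [← A.playColour_congr hj]
  rw [← A.playColour_congr fun w hw => hj w (hw.trans_le hij)] at h
  unfold Algorithm.playColour at h ⊢
  by_cases hv : v < i
  · rw [dif_pos hv] at h
    rw [dif_pos (hv.trans_le hij)]
    exact A.irrevocable (j + 1) (playGraph (Function.update s j 0) (j + 1))
      (isArborescence_playGraph (Function.update_self ..))
      (isGeometricLeafToRoot_playGraph _ _) i j hij j.le_succ ⟨v, hv⟩ c h
  · rw [dif_neg hv] at h
    cases h

theorem Extends.playColour_mono {A : Algorithm k} {s s' : ℕ → ℕ} {n n' v : ℕ}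
    (h : Extends s n s' n') {c : Fin k} (hc : A.playColour s n v = some c) :
    A.playColour s' n' v = some c := by
  rw [← A.playColour_congr h.2.1] at hc
  exact A.playColour_mono h.1 hc

/-- After `n` steps of the play `s`, the colours of the first `q` vertices do not change any more as
long as the play is continued without touching the roots that are there. -/
def Algorithm.Frozen (A : Algorithm k) (s : ℕ → ℕ) (n q : ℕ) : Prop :=
  ∀ s' n', Extends s n s' n' → ∀ v < q, A.playColour s' n' v = A.playColour s n v

/-- A continuation on which as many as possible of the present vertices are coloured freezes
their colours. -/
theorem Algorithm.exists_frozen (A : Algorithm k) (s : ℕ → ℕ) (n : ℕ) :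
    ∃ s' n', Extends s n s' n' ∧ A.Frozen s' n' n := by
  classical
  let coloured (s' : ℕ → ℕ) (n' : ℕ) : Finset ℕ :=
    (Finset.range n).filter fun v => A.playColour s' n' v ≠ none
  let P (j : ℕ) : Prop := ∃ s' n', Extends s n s' n' ∧ (coloured s' n').card = j
  have hb : ∀ j, P j → j ≤ n := by
    rintro j ⟨s', n', -, rfl⟩
    simpa using Finset.card_filter_le (Finset.range n) fun v => A.playColour s' n' v ≠ none
  have h0 : P (coloured s n).card := ⟨s, n, Extends.refl s n, rfl⟩
  obtain ⟨s', n', hext, hcard⟩ : P (Nat.findGreatest P n) := Nat.findGreatest_spec (hb _ h0) h0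
  refine ⟨s', n', hext, fun s'' n'' hext' v hv => ?_⟩
  have hsub : coloured s' n' ⊆ coloured s'' n'' := by
    intro w hw
    rw [Finset.mem_filter] at hw ⊢
    obtain ⟨c, hc⟩ := Option.ne_none_iff_exists'.1 hw.2
    exact ⟨hw.1, by rw [hext'.playColour_mono hc]; exact Option.some_ne_none c⟩
  have hP : P (coloured s'' n'').card := ⟨s'', n'', hext.trans hext', rfl⟩
  have heq : coloured s' n' = coloured s'' n'' :=
    Finset.eq_of_subset_of_card_le hsub (hcard ▸ Nat.le_findGreatest (hb _ hP) hP)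
  cases hc : A.playColour s' n' v with
  | some c => exact hext'.playColour_mono hc
  | none =>
    by_contra hne
    have hmem : v ∈ coloured s'' n'' := Finset.mem_filter.2 ⟨Finset.mem_range.2 hv, hne⟩
    rw [← heq] at hmem
    exact (Finset.mem_filter.1 hmem).2 hc

/-! ### Types of vertices -/

/-- The possible types of depth `d` of a vertex: a colour (or none) and, for positive depth, the set
of types of depth `d - 1` of the out-neighbours. -/
def VertexType (k : ℕ) : ℕ → Type
  | 0 => Option (Fin k)
  | d + 1 => Option (Fin k) × Set (VertexType k d)

theorem finite_vertexType (k : ℕ) : ∀ d, Finite (VertexType k d)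
  | 0 => inferInstanceAs (Finite (Option (Fin k)))
  | d + 1 =>
    haveI := finite_vertexType k d
    inferInstanceAs (Finite (Option (Fin k) × Set (VertexType k d)))

/-- The type of depth `d` of a vertex of the play `s` with respect to the partial colouring `f`. -/
def vertexType (s : ℕ → ℕ) (f : ℕ → Option (Fin k)) : (d : ℕ) → ℕ → VertexType k d
  | 0, v => f v
  | d + 1, v => (f v, {t | ∃ w, PlayAdj s v w ∧ vertexType s f d w = t})

theorem vertexType_congr {s s' : ℕ → ℕ} {f f' : ℕ → Option (Fin k)} {q : ℕ}
    (hs : ∀ v < q, s' v = s v) (hf : ∀ v < q, f' v = f v) (d : ℕ) :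
    ∀ v < q, vertexType s' f' d v = vertexType s f d v := by
  induction d with
  | zero => exact hf
  | succ d ih =>
    intro v hv
    refine Prod.ext (hf v hv) (Set.ext fun t => exists_congr fun w => ?_)
    rw [playAdj_congr hs hv]
    refine and_congr_right fun hw => ?_
    rw [ih w (hw.2.1.trans hv)]

theorem eq_of_vertexType_eq {s : ℕ → ℕ} {f f' : ℕ → Option (Fin k)} {d y z : ℕ}
    (h : vertexType s f d y = vertexType s f' d z) : f y = f' z := by
  cases d with
  | zero => exact h
  | succ d => exact congrArg Prod.fst h

/-- If `z` is joined to `y`, and the type of `z` in a later colouring `f'` equals the type of `y` in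
the earlier colouring `f`, then some path of length `d` from `y` is such that a colour in `f`, once it
has appeared, is kept till the end of the path. -/
theorem exists_path_of_vertexType_eq {s : ℕ → ℕ} {f f' : ℕ → Option (Fin k)}
    (hf : ∀ v c, f v = some c → f' v = some c) (d : ℕ) :
    ∀ y z, PlayAdj s z y → vertexType s f d y = vertexType s f' d z →
      ∃ p : ℕ → ℕ, p 0 = y ∧ ∀ j < d, PlayAdj s (p j) (p (j + 1)) ∧
        ∀ c, f (p j) = some c → f (p (j + 1)) = some c := by
  induction d with
  | zero => exact fun y _ _ _ => ⟨fun _ => y, rfl, fun j hj => absurd hj (Nat.not_lt_zero j)⟩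
  | succ d ih =>
    intro y z hzy h
    -- The later type of `y` is among those of the out-neighbours of `z`, so it is the earlier
    -- type of an out-neighbour `y₁` of `y`.
    have hmem : vertexType s f' d y ∈ {t | ∃ w, PlayAdj s y w ∧ vertexType s f d w = t} := by
      rw [show {t | ∃ w, PlayAdj s y w ∧ vertexType s f d w = t} =
        {t | ∃ w, PlayAdj s z w ∧ vertexType s f' d w = t} from congrArg Prod.snd h]
      exact ⟨y, hzy, rfl⟩
    obtain ⟨y₁, hadj, hty⟩ := hmem
    obtain ⟨p, hp0, hp⟩ := ih y₁ y hadj hty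
    refine ⟨fun j => Nat.casesOn j y p, rfl, fun j hj => ?_⟩
    cases j with
    | zero =>
      change PlayAdj s y (p 0) ∧ ∀ c, f y = some c → f (p 0) = some c
      rw [hp0]
      exact ⟨hadj, fun c hc => (eq_of_vertexType_eq hty).trans (hf y c hc)⟩
    | succ j => exact hp j (Nat.lt_of_succ_lt_succ hj)

/-- The types of depth `d`, after `n` steps of the play `s`, of the roots `v` with `a ≤ v < b`. -/
def Algorithm.rootTypes (A : Algorithm k) (d : ℕ) (s : ℕ → ℕ) (n a b : ℕ) : Set (VertexType k d) :=
  {t | ∃ v, a ≤ v ∧ v < b ∧ IsPlayRoot s n v ∧ vertexType s (A.playColour s n) d v = t}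

theorem Algorithm.rootTypes_mono (A : Algorithm k) {d : ℕ} {s : ℕ → ℕ} {n a b a' b' : ℕ}
    (ha : a' ≤ a) (hb : b ≤ b') : A.rootTypes d s n a b ⊆ A.rootTypes d s n a' b' := by
  rintro t ⟨v, hav, hvb, h⟩
  exact ⟨v, ha.trans hav, hvb.trans_le hb, h⟩

theorem Algorithm.Frozen.rootTypes_subset {A : Algorithm k} {d : ℕ} {s s' : ℕ → ℕ} {n n' a q : ℕ}
    (h : A.Frozen s n q) (hq : q ≤ n) (hext : Extends s n s' n') :
    A.rootTypes d s n a q ⊆ A.rootTypes d s' n' a q := by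
  rintro t ⟨v, hav, hvq, hr, rfl⟩
  exact ⟨v, hav, hvq, hext.isPlayRoot (hvq.trans_le hq) hr,
    vertexType_congr (fun u hu => hext.2.1 u (hu.trans_le hq)) (h s' n' hext) d v hvq⟩

/-! ### The adversary -/

/-- At no stage of a play does a path of length `m` have at most one colour. -/
def Algorithm.TwoColoured (A : Algorithm k) (m : ℕ) : Prop :=
  ∀ (s : ℕ → ℕ) (n : ℕ) (p : Fin (m + 1) → ℕ), (∀ j, p j < n) →
    (∀ j : Fin m, PlayAdj s (p j.castSucc) (p j.succ)) →
      ¬ {c | ∃ j, A.playColour s n (p j) = some c}.Subsingleton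

/-- A vertex that is joined to `x` never gets a type that `x` had before. -/
theorem Algorithm.TwoColoured.vertexType_ne {A : Algorithm k} {m : ℕ} (hA : A.TwoColoured m)
    {s : ℕ → ℕ} {n n' x z : ℕ} (hn : n ≤ n') (hx : x < n) (hz : PlayAdj s z x) :
    vertexType s (A.playColour s n) m x ≠ vertexType s (A.playColour s n') m z := by
  intro h
  obtain ⟨p, hp0, hp⟩ :=
    exists_path_of_vertexType_eq (fun _ _ => A.playColour_mono hn) m x z hz h
  have hlt : ∀ j ≤ m, p j < n := by
    intro j
    induction j with
    | zero => exact fun _ => hp0 ▸ hx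
    | succ j ih => exact fun hj => (hp j hj).1.2.1.trans (ih (Nat.le_of_succ_le hj))
  have hkeep : ∀ i j, i ≤ j → j ≤ m → ∀ c, A.playColour s n (p i) = some c →
      A.playColour s n (p j) = some c := by
    intro i j hij
    induction j, hij using Nat.le_induction with
    | base => exact fun _ c hc => hc
    | succ j _ ih => exact fun hj c hc => (hp j hj).2 c (ih (Nat.le_of_succ_le hj) c hc)
  refine hA s n (fun j => p j) (fun j => hlt j (Nat.le_of_lt_succ j.2))
    (fun j => (hp j j.2).1) ?_
  -- Every colour that occurs on the path is the colour of its last vertex.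
  rintro c ⟨i, hi⟩ c' ⟨i', hi'⟩
  have h1 := hkeep i m (Nat.le_of_lt_succ i.2) le_rfl c hi
  have h2 := hkeep i' m (Nat.le_of_lt_succ i'.2) le_rfl c' hi'
  exact Option.some.inj (h1.symm.trans h2)

/-- Any play can be continued, without touching its roots, so that among its new roots there are some
with at least `t` distinct types in total, whose colours are frozen. -/
theorem Algorithm.TwoColoured.exists_many_types {A : Algorithm k} {m : ℕ} (hA : A.TwoColoured m)
    (t : ℕ) : ∀ s n, ∃ q s' n', Extends s n s' n' ∧ n ≤ q ∧ q ≤ n' ∧ A.Frozen s' n' q ∧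
      t ≤ (A.rootTypes m s' n' n q).ncard := by
  have := finite_vertexType k m
  induction t with
  | zero =>
    intro s n
    obtain ⟨s', n', hext, hfr⟩ := A.exists_frozen s n
    exact ⟨n, s', n', hext, le_rfl, hext.1, hfr, Nat.zero_le _⟩
  | succ t ih =>
    intro s n
    obtain ⟨q₁, s₁, n₁, hext₁, hnq₁, hq₁, hfr₁, hcard₁⟩ := ih s n
    obtain ⟨q₂, s₂, n₂, hext₂, hnq₂, hq₂, hfr₂, hcard₂⟩ := ih s₁ n₁
    by_cases hsub : A.rootTypes m s₁ n₁ n q₁ ⊆ A.rootTypes m s₂ n₂ n₁ q₂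
    · -- Join all roots of the second set (and those after it) under the new vertex `n₂`.
      let s₃ := Function.update s₂ n₂ n₁
      have hs₃ : ∀ w < n₂, s₃ w = s₂ w := update_eq_of_lt s₂ n₂ n₁
      have hext₃ : Extends s₁ n₁ s₃ (n₂ + 1) := by
        refine ⟨hext₂.1.trans n₂.le_succ,
          fun u hu => (hs₃ u (hu.trans_le hext₂.1)).trans (hext₂.2.1 u hu), fun u hu hu' => ?_⟩
        rcases Nat.lt_succ_iff_lt_or_eq.1 hu' with hlt | heq
        · rw [hs₃ u hlt]
          exact hext₂.2.2 u hu hlt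
        · rw [heq]
          exact (Function.update_self n₂ n₁ s₂).ge
      obtain ⟨s₄, n₄, hext₄, hfr₄⟩ := A.exists_frozen s₃ (n₂ + 1)
      have hext₁₄ : Extends s₁ n₁ s₄ n₄ := hext₃.trans hext₄
      have hs₄ : ∀ w < n₂, s₄ w = s₂ w := fun w hw =>
        (hext₄.2.1 w (hw.trans n₂.lt_succ_self)).trans (hs₃ w hw)
      have hs₄n : s₄ n₂ = n₁ :=
        (hext₄.2.1 n₂ n₂.lt_succ_self).trans (Function.update_self ..)
      have hnew : vertexType s₄ (A.playColour s₄ n₄) m n₂ ∉ A.rootTypes m s₂ n₂ n₁ q₂ := by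
        rintro ⟨x, hx₁, hxq, hr, hx⟩
        have hxn : x < n₂ := hxq.trans_le hq₂
        refine hA.vertexType_ne (s := s₄) (n := n₂) (n' := n₄) (x := x) (z := n₂)
          (n₂.le_succ.trans hext₄.1) hxn
          ⟨hs₄n.trans_le hx₁, hxn, fun w hw hw' => hs₄ w hw' ▸ hr w hw hw'⟩ ?_
        rw [← hx, A.playColour_congr hs₄]
        exact vertexType_congr hs₄ (fun _ _ => rfl) m x hxn
      refine ⟨n₂ + 1, s₄, n₄, hext₁.trans hext₁₄, hext₁.1.trans hext₃.1, hext₄.1, hfr₄, ?_⟩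
      have hins : insert (vertexType s₄ (A.playColour s₄ n₄) m n₂) (A.rootTypes m s₁ n₁ n q₁) ⊆
          A.rootTypes m s₄ n₄ n (n₂ + 1) := by
        refine Set.insert_subset ⟨n₂, hext₁.1.trans hext₂.1, n₂.lt_succ_self, ?_, rfl⟩
          ((hfr₁.rootTypes_subset hq₁ hext₁₄).trans
            (A.rootTypes_mono le_rfl (hq₁.trans (hext₂.1.trans n₂.le_succ))))
        exact hext₄.isPlayRoot n₂.lt_succ_self
          fun w hw hw' => absurd hw (not_lt.2 (Nat.le_of_lt_succ hw'))
      calc t + 1 ≤ (A.rootTypes m s₁ n₁ n q₁).ncard + 1 := Nat.succ_le_succ hcard₁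
        _ = (insert (vertexType s₄ (A.playColour s₄ n₄) m n₂)
              (A.rootTypes m s₁ n₁ n q₁)).ncard :=
          (Set.ncard_insert_of_notMem (fun hmem => hnew (hsub hmem)) (Set.toFinite _)).symm
        _ ≤ _ := Set.ncard_le_ncard hins (Set.toFinite _)
    · -- Both sets together have a type more than the second one.
      obtain ⟨τ, hτ₁, hτ₂⟩ := Set.not_subset.1 hsub
      refine ⟨q₂, s₂, n₂, hext₁.trans hext₂, hext₁.1.trans hnq₂, hq₂, hfr₂, ?_⟩
      have hins : insert τ (A.rootTypes m s₂ n₂ n₁ q₂) ⊆ A.rootTypes m s₂ n₂ n q₂ :=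
        Set.insert_subset (A.rootTypes_mono le_rfl (hq₁.trans hnq₂)
          (hfr₁.rootTypes_subset hq₁ hext₂ hτ₁)) (A.rootTypes_mono hext₁.1 le_rfl)
      calc t + 1 ≤ (A.rootTypes m s₂ n₂ n₁ q₂).ncard + 1 := Nat.succ_le_succ hcard₂
        _ = (insert τ (A.rootTypes m s₂ n₂ n₁ q₂)).ncard :=
          (Set.ncard_insert_of_notMem hτ₂ (Set.toFinite _)).symm
        _ ≤ _ := Set.ncard_le_ncard hins (Set.toFinite _)

/-- No algorithm keeps all paths of length `m` in all plays at two colours. -/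
theorem Algorithm.not_twoColoured (A : Algorithm k) (m : ℕ) : ¬ A.TwoColoured m := by
  intro hA
  have := finite_vertexType k m
  obtain ⟨q, s, n, -, -, -, -, h⟩ := hA.exists_many_types (Nat.card (VertexType k m) + 1) id 0
  exact absurd (h.trans (Set.ncard_le_card _)) (Nat.not_succ_le_self _)

/-- Every algorithm can be forced to produce a path of length `m` with at most one colour. -/
theorem Algorithm.exists_subsingleton_pathColours (A : Algorithm k) (m : ℕ) :
    ∃ (n : ℕ) (G : Digraph (Fin n)), IsArborescence G ∧ IsGeometricLeafToRoot G ∧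
      ∃ (i : ℕ) (hi : i ≤ n) (p : Fin (m + 1) → Fin i), IsDirectedPath (stage G i hi) m p ∧
        (pathColours (A.colour i (stage G i hi)) p).Subsingleton := by
  have h := A.not_twoColoured m
  unfold Algorithm.TwoColoured at h
  push Not at h
  obtain ⟨s, n, p, hpn, hadj, hsub⟩ := h
  have hs := update_eq_of_lt s n 0
  refine ⟨n + 1, playGraph (Function.update s n 0) (n + 1),
    isArborescence_playGraph (Function.update_self ..), isGeometricLeafToRoot_playGraph _ _,
    n, n.le_succ, fun j => ⟨p j, hpn j⟩, ⟨?_, fun j => ?_⟩, ?_⟩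
  · have hanti : StrictAnti p := Fin.strictAnti_iff_succ_lt.2 fun j => (hadj j).2.1
    exact fun i j hij => hanti.injective (congrArg Fin.val hij)
  · exact (playAdj_congr hs (hpn _) _).2 (hadj j)
  · rw [← A.playColour_congr hs] at hsub
    refine hsub.anti ?_
    rintro c ⟨j, hj⟩
    refine ⟨j, ?_⟩
    unfold Algorithm.playColour
    rw [dif_pos (hpn j)]
    exact hj

end SemiOnline

theorem mainTheorem1 (k m : ℕ) :
    (¬ ∃ A : SemiOnline.Algorithm k, A.IsProper m) ∧
    ∀ A : SemiOnline.Algorithm k,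
      ∃ (n : ℕ) (G : Digraph (Fin n)),
        SemiOnline.IsArborescence G ∧ SemiOnline.IsGeometricLeafToRoot G ∧
        ∃ (i : ℕ) (hi : i ≤ n) (p : Fin (m + 1) → Fin i),
          SemiOnline.IsDirectedPath (SemiOnline.stage G i hi) m p ∧
          (SemiOnline.pathColours (A.colour i (SemiOnline.stage G i hi)) p).Subsingleton := by
  refine ⟨?_, fun A => A.exists_subsingleton_pathColours m⟩
  rintro ⟨A, hA⟩
  obtain ⟨n, G, harb, hgeo, i, hi, p, hp, hsub⟩ := A.exists_subsingleton_pathColours m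
  exact (hA n G harb hgeo i hi p hp).not_subsingleton hsub
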